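/- Let $D=\{\zeta\in\mathbb{C}:|\zeta|<1\}$. For a domain (nonempty connected open set) $\Omega\subseteq\mathbb{C}$, a point $z\in\Omega$ and a vector $\xi\in\mathbb{C}$, the infinitesimal Kobayashi length is $$F_K^\Omega(z,\xi)=\inf\{\alpha>0:\ \exists f:D\to\Omega \text{ holomorphic with } f(0)=z,\ f'(0)=\xi/\alpha\},$$ and the infinitesimal Carathéodory length is $$F_C^\Omega(z,\xi)=\sup\{|f'(z)\,\xi|:\ f:\Omega\to D \text{ holomorphic with } f(z)=0\}.$$ Let $\Omega\subseteq\mathbb{C}$ be a bounded domain with $C^2$ boundary, i.e. every point of $\partial\Omega$ has a neighbourhood in which, after a rotation of the plane, $\partial\Omega$ is the graph of a $C^2$ function. Let $\delta(z)$ denote the Euclidean distance from $z$ to $\partial\Omega$. Then there are constants $c,C>0$ (depending only on $\Omega$) such that $$\frac{c\,|\xi|}{\delta(z)}\le F_K^\Omega(z,\xi)\le\frac{C\,|\xi|}{\delta(z)}\qquad\text{for all } z\in\Omega,\ \xi\in\mathbb{C},$$ and there are constants $c',C'>0$ (depending only on $\Omega$) such that $$\frac{c'\,|\xi|}{\delta(z)}\le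 F_C^\Omega(z,\xi)\le\frac{C'\,|\xi|}{\delta(z)}\qquad\text{for all } z\in\Omega,\ \xi\in\mathbb{C}.$$ -/

import Mathlib

noncomputable section

namespace PlanarMetric

/-- The open unit disc `D` in the complex plane. -/
def unitDisc : Set ℂ := Metric.ball 0 1

/-- The boundary of `Ω` is locally the graph of a `C²` function: every boundary point has an open
neighbourhood in which, after a rotation of the plane (multiplication by a number `a` of modulus
one), the topological boundary of `Ω` coincides with the graph `y = φ x` of a twice continuously
differentiable real function. -/
def HasC2Boundary (Ω : Set ℂ) : Prop :=
  ∀ p ∈ frontier Ω, ∃ (a : ℂ) (φ : ℝ → ℝ) (U : Set ℂ),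
    ‖a‖ = 1 ∧ ContDiff ℝ 2 φ ∧ IsOpen U ∧ p ∈ U ∧
      ∀ z ∈ U, z ∈ frontier Ω ↔ (a * z).im = φ (a * z).re

/-- The Euclidean distance from `z` to the boundary of `Ω`. -/
def boundaryDist (Ω : Set ℂ) (z : ℂ) : ℝ := Metric.infDist z (frontier Ω)

/-- The infinitesimal Kobayashi (Kobayashi–Royden) length of the vector `ξ` at the point `P`: the
infimum of the `α > 0` for which some holomorphic `f : D → Ω` has `f 0 = P` and `f' 0 = ξ / α`.
For `Ω` open and `P ∈ Ω` the set of these `α` is nonempty, and `0` is a lower bound. -/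
def kobayashi (Ω : Set ℂ) (P ξ : ℂ) : ℝ :=
  sInf {α : ℝ | 0 < α ∧ ∃ f : ℂ → ℂ, DifferentiableOn ℂ f unitDisc ∧ Set.MapsTo f unitDisc Ω ∧
    f 0 = P ∧ deriv f 0 = ξ / (α : ℂ)}

/-- The infinitesimal Carathéodory length of the vector `ξ` at the point `P`: the supremum of
`|f' P * ξ|` over the holomorphic `f : Ω → D` with `f P = 0`. For `Ω` open and `P ∈ Ω` the set of
these numbers is nonempty, and bounded above by Cauchy's estimate. -/
def caratheodory (Ω : Set ℂ) (P ξ : ℂ) : ℝ :=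
  sSup {s : ℝ | ∃ f : ℂ → ℂ, DifferentiableOn ℂ f Ω ∧ Set.MapsTo f Ω unitDisc ∧
    f P = 0 ∧ s = ‖deriv f P * ξ‖}

end PlanarMetric

end

namespace PlanarMetric

open Set Metric Filter Topology

/-! With δ the boundary distance, everything follows from the chain c|ξ|/δ ≤ F_C ≤ F_K ≤ |ξ|/δ. The
last inequality comes from affine discs in the ball of radius δ (`kobayashi_le_of_ball_subset`), the
middle one from Schwarz's lemma (`norm_deriv_mul_le`).

The first needs a map Ω → D vanishing at z with derivative of order 1/δ
(`exists_mapsTo_unitDisc_of_arc`). For z near the boundary, let a be a nearest boundary point and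
follow the boundary from a to some b with |b - a| ≥ 2δ. Since this arc misses Ω, (w - b)/(w - a) has
a holomorphic logarithm on Ω, however Ω is connected. Let k be its square root scaled to k(z) = 1.
Then k stays away from -1 (`le_norm_sqrt_add_one`), so 1/(k + 1) is bounded, while |k'(z)| is of
order 1/δ. Away from the boundary a scaled translation is enough. -/

/-- `γ` is a `C¹` curve in `K` that starts at `q` and ends at distance at least `d` from `q`. -/
def HasArcFrom (K : Set ℂ) (q : ℂ) (d : ℝ) : Prop :=
  ∃ γ : ℝ → ℂ, ContDiff ℝ 1 γ ∧ γ 0 = q ∧ d ≤ ‖γ 1 - q‖ ∧ ∀ t ∈ Icc (0 : ℝ) 1, γ t ∈ K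

theorem HasArcFrom.mono {K : Set ℂ} {q : ℂ} {d e : ℝ} (h : HasArcFrom K q d) (hed : e ≤ d) :
    HasArcFrom K q e := by
  obtain ⟨γ, h1, h2, h3, h4⟩ := h
  exact ⟨γ, h1, h2, hed.trans h3, h4⟩

/-! ### The boundary contains arcs of uniform size -/

/-- Moving the graph parameter by η/2 moves the rotated real part by η/2, hence the point by at
least that; one η serves all boundary points near p. -/
theorem hasArcFrom_nhds {Ω : Set ℂ} (hC2 : HasC2Boundary Ω) {p : ℂ} (hp : p ∈ frontier Ω) :
    ∃ d > 0, ∀ᶠ q in 𝓝 p, q ∈ frontier Ω → HasArcFrom (frontier Ω) q d := by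
  obtain ⟨a, φ, U, ha, hφ, hU, hpU, hgraph⟩ := hC2 p hp
  have ha0 : a ≠ 0 := by
    rintro rfl
    simp at ha
  set Γ : ℝ → ℂ := fun x => a⁻¹ * ((x : ℂ) + (φ x : ℂ) * Complex.I) with hΓ
  have hΓd : ContDiff ℝ 2 Γ := by
    have h1 : ContDiff ℝ 2 (fun x : ℝ => (x : ℂ)) := Complex.ofRealCLM.contDiff
    have h2 : ContDiff ℝ 2 (fun x : ℝ => (φ x : ℂ)) := Complex.ofRealCLM.contDiff.comp hφ
    exact contDiff_const.mul (h1.add (h2.mul contDiff_const))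
  have hmul : ∀ x, a * Γ x = (x : ℂ) + (φ x : ℂ) * Complex.I := fun x => by
    simp only [hΓ]
    field_simp
  have hre : ∀ x, (a * Γ x).re = x := fun x => by rw [hmul]; simp
  have him : ∀ x, (a * Γ x).im = φ x := fun x => by rw [hmul]; simp
  have hΓq : ∀ q ∈ U, q ∈ frontier Ω → Γ (a * q).re = q := fun q hq hqf => by
    have h := (hgraph q hq).1 hqf
    apply mul_left_cancel₀ ha0
    apply Complex.ext
    · rw [hre]
    · rw [him, h]
  have hev : ∀ᶠ x in 𝓝 (a * p).re, Γ x ∈ U := by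
    apply hΓd.continuous.continuousAt.eventually
    rw [hΓq p hpU hp]
    exact hU.mem_nhds hpU
  obtain ⟨η, hη, hball⟩ := Metric.eventually_nhds_iff.1 hev
  refine ⟨η / 2, by positivity, ?_⟩
  have hnear : ∀ᶠ q in 𝓝 p, dist (a * q).re (a * p).re < η / 2 := by
    have hc : Continuous fun q : ℂ => (a * q).re := by fun_prop
    exact hc.continuousAt.eventually (Metric.ball_mem_nhds _ (by positivity))
  filter_upwards [hnear, hU.mem_nhds hpU] with q hq hqU hqf
  refine ⟨fun t => Γ ((a * q).re + t * (η / 2)), ?_, ?_, ?_, ?_⟩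
  · exact (hΓd.of_le (by norm_num)).comp (by fun_prop)
  · simpa using hΓq q hqU hqf
  · have h1 : (a * (Γ ((a * q).re + 1 * (η / 2)) - q)).re = η / 2 := by
      rw [mul_sub, Complex.sub_re, hre]
      ring
    have h2 := Complex.re_le_norm (a * (Γ ((a * q).re + 1 * (η / 2)) - q))
    rwa [h1, norm_mul, ha, one_mul] at h2
  · intro t ht
    refine (hgraph _ (hball ?_)).2 (by rw [him, hre])
    rw [Real.dist_eq, abs_lt] at hq ⊢
    constructor <;> nlinarith [ht.1, ht.2, hq.1, hq.2]

theorem exists_uniform_hasArcFrom {Ω : Set ℂ} (hbdd : Bornology.IsBounded Ω)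
    (hC2 : HasC2Boundary Ω) :
    ∃ d > 0, ∀ q ∈ frontier Ω, HasArcFrom (frontier Ω) q d := by
  have hcomp : IsCompact (frontier Ω) :=
    hbdd.isCompact_closure.of_isClosed_subset isClosed_frontier frontier_subset_closure
  -- Membership in the frontier is kept as a hypothesis because the sets in the compactness
  -- induction need not lie in it.
  suffices h : ∃ d > 0, ∀ q ∈ frontier Ω, q ∈ frontier Ω → HasArcFrom (frontier Ω) q d by
    obtain ⟨d, hd, h⟩ := h
    exact ⟨d, hd, fun q hq => h q hq hq⟩
  refine hcomp.induction_on (p := fun s => ∃ d > 0, ∀ q ∈ s, q ∈ frontier Ω →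
    HasArcFrom (frontier Ω) q d) ⟨1, one_pos, by simp⟩ ?_ ?_ ?_
  · rintro s t hst ⟨d, hd, h⟩
    exact ⟨d, hd, fun q hq => h q (hst hq)⟩
  · rintro s t ⟨d, hd, h⟩ ⟨e, he, h'⟩
    refine ⟨min d e, lt_min hd he, fun q hq hqf => ?_⟩
    rcases hq with hq | hq
    · exact (h q hq hqf).mono (min_le_left _ _)
    · exact (h' q hq hqf).mono (min_le_right _ _)
  · intro p hp
    obtain ⟨d, hd, h⟩ := hasArcFrom_nhds hC2 hp
    exact ⟨_, mem_nhdsWithin_of_mem_nhds h, d, hd, fun q hq => hq⟩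

/-! ### A holomorphic logarithm of `(b - w) / (a - w)` off an arc from `a` to `b` -/

section Logarithm

variable {γ : ℝ → ℂ}

theorem continuousAt_deriv_div_sub (hγ : ContDiff ℝ 1 γ) {w : ℂ} {t : ℝ} (h : γ t ≠ w) :
    ContinuousAt (fun s => deriv γ s / (γ s - w)) t :=
  (hγ.continuous_deriv le_rfl).continuousAt.div
    (hγ.continuous.continuousAt.sub continuousAt_const) (sub_ne_zero.2 h)

theorem intervalIntegrable_deriv_div_sub (hγ : ContDiff ℝ 1 γ) {w : ℂ} {s : ℝ}
    (hs : s ∈ Icc (0 : ℝ) 1) (hw : ∀ t ∈ Icc (0 : ℝ) 1, γ t ≠ w) :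
    IntervalIntegrable (fun t => deriv γ t / (γ t - w)) MeasureTheory.volume 0 s := by
  apply ContinuousOn.intervalIntegrable
  rw [uIcc_of_le hs.1]
  exact fun t ht => (continuousAt_deriv_div_sub hγ (hw t ⟨ht.1, ht.2.trans hs.2⟩)).continuousWithinAt

/-- With G the integral up to s, (γ - w) exp(-G) has derivative zero, so its values at 0 and 1
agree. -/
theorem exp_integral_deriv_div_sub (hγ : ContDiff ℝ 1 γ) {w : ℂ}
    (hw : ∀ t ∈ Icc (0 : ℝ) 1, γ t ≠ w) :
    Complex.exp (∫ t in (0 : ℝ)..1, deriv γ t / (γ t - w)) = (γ 1 - w) / (γ 0 - w) := by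
  set G : ℝ → ℂ := fun s => ∫ t in (0 : ℝ)..s, deriv γ t / (γ t - w) with hG
  have hopen : IsOpen {t | γ t ≠ w} := isOpen_ne.preimage hγ.continuous
  have hGd : ∀ s ∈ Icc (0 : ℝ) 1, HasDerivAt G (deriv γ s / (γ s - w)) s := fun s hs =>
    intervalIntegral.integral_hasDerivAt_right (intervalIntegrable_deriv_div_sub hγ hs hw)
      (ContinuousAt.stronglyMeasurableAtFilter hopen
        (fun t ht => continuousAt_deriv_div_sub hγ ht) s (hw s hs))
      (continuousAt_deriv_div_sub hγ (hw s hs))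
  have hH : ∀ s ∈ Icc (0 : ℝ) 1, HasDerivAt (fun t => (γ t - w) * Complex.exp (-G t)) 0 s := by
    intro s hs
    have h1 : HasDerivAt (fun t => γ t - w) (deriv γ s) s :=
      ((hγ.differentiable one_ne_zero s).hasDerivAt).sub_const w
    have h2 : (γ s - w) * (deriv γ s / (γ s - w)) = deriv γ s :=
      mul_div_cancel₀ _ (sub_ne_zero.2 (hw s hs))
    refine (h1.fun_mul (hGd s hs).fun_neg.cexp).congr_deriv ?_
    linear_combination -Complex.exp (-G s) * h2
  have hconst := constant_of_has_deriv_right_zero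
    (fun s hs => (hH s hs).continuousAt.continuousWithinAt)
    (fun s hs => (hH s (Ico_subset_Icc_self hs)).hasDerivWithinAt) 1 (right_mem_Icc.2 zero_le_one)
  have h0 := sub_ne_zero.2 (hw 0 (left_mem_Icc.2 zero_le_one))
  have hG0 : G 0 = 0 := intervalIntegral.integral_same
  rw [hG0, neg_zero, Complex.exp_zero, mul_one, Complex.exp_neg] at hconst
  change Complex.exp (G 1) = _
  have := Complex.exp_ne_zero (G 1)
  field_simp at hconst ⊢
  exact hconst.symm

theorem differentiableAt_integral_deriv_div_sub (hγ : ContDiff ℝ 1 γ) {w : ℂ}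
    (hw : w ∉ γ '' Icc 0 1) :
    DifferentiableAt ℂ (fun z => ∫ t in (0 : ℝ)..1, deriv γ t / (γ t - z)) w := by
  have hcl : IsClosed (γ '' Icc 0 1) := (isCompact_Icc.image hγ.continuous).isClosed
  obtain ⟨ε, hε, hball⟩ := Metric.isOpen_iff.1 hcl.isOpen_compl w hw
  have hmem : ∀ z ∈ ball w ε, ∀ t ∈ Icc (0 : ℝ) 1, γ t ≠ z := fun z hz t ht h =>
    hball hz ⟨t, ht, h⟩
  -- Halving the radius keeps the denominators bounded below, which gives the dominating function.
  have hsep : ∀ z ∈ ball w (ε / 2), ∀ t ∈ Icc (0 : ℝ) 1, ε / 2 ≤ ‖γ t - z‖ := by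
    intro z hz t ht
    by_contra! hlt
    refine hmem (γ t) ?_ t ht rfl
    rw [mem_ball, dist_eq_norm] at hz ⊢
    linarith [norm_sub_le_norm_sub_add_norm_sub (γ t) z w]
  have hsub : ball w (ε / 2) ⊆ ball w ε := ball_subset_ball (by linarith)
  have hI : ∀ t ∈ uIoc (0 : ℝ) 1, t ∈ Icc (0 : ℝ) 1 := fun t ht =>
    Ioc_subset_Icc_self (by rwa [uIoc_of_le zero_le_one] at ht)
  have hint : ∀ z ∈ ball w ε, IntervalIntegrable (fun t => deriv γ t / (γ t - z))
      MeasureTheory.volume 0 1 := fun z hz =>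
    intervalIntegrable_deriv_div_sub hγ (right_mem_Icc.2 zero_le_one) (hmem z hz)
  have hcd := hγ.continuous_deriv le_rfl
  refine (intervalIntegral.hasDerivAt_integral_of_dominated_loc_of_deriv_le
    (F' := fun z t => deriv γ t / (γ t - z) ^ 2) (bound := fun t => ‖deriv γ t‖ / (ε / 2) ^ 2)
    (ball_mem_nhds w (half_pos hε)) ?_ (hint w (mem_ball_self hε)) ?_ ?_ ?_ ?_).2.differentiableAt
  · filter_upwards [ball_mem_nhds w hε] with z hz
    exact (intervalIntegrable_iff.1 (hint z hz)).aestronglyMeasurable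
  · refine (intervalIntegrable_iff.1 (ContinuousOn.intervalIntegrable ?_)).aestronglyMeasurable
    rw [uIcc_of_le zero_le_one]
    refine hcd.continuousOn.div ((hγ.continuous.sub continuous_const).pow 2).continuousOn ?_
    exact fun t ht => pow_ne_zero 2 (sub_ne_zero.2 (hmem w (mem_ball_self hε) t ht))
  · refine .of_forall fun t ht z hz => ?_
    rw [norm_div, norm_pow]
    gcongr
    exact hsep z hz t (hI t ht)
  · exact (hcd.norm.div_const _).intervalIntegrable 0 1
  · refine .of_forall fun t ht z hz => ?_
    have hne := sub_ne_zero.2 (hmem z (hsub hz) t (hI t ht))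
    refine ((hasDerivAt_const z (deriv γ t)).fun_div
      ((hasDerivAt_id z).const_sub (γ t)) hne).congr_deriv ?_
    simp

end Logarithm

/-! ### A bounded function from a square root of a Möbius map -/

/-- If `k² = ((w - b)(z - a)) / ((w - a)(z - b))` on `Ω`, `k z = 1` and `a` is much closer to `z`
than to `b`, then `k` stays away from `-1`. -/
theorem le_norm_sqrt_add_one {Ω : Set ℂ} {k : ℂ → ℂ} {z a b : ℂ} {δ : ℝ} (hδ : 0 < δ)
    (hball : ball z δ ⊆ Ω) (hk : ContinuousOn k Ω) (hkz : k z = 1) (hza : ‖z - a‖ = δ)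
    (hba : 2 * δ ≤ ‖b - a‖) (ha : a ∉ Ω)
    (hsq : ∀ w ∈ Ω, k w ^ 2 = ((w - b) * (z - a)) / ((w - a) * (z - b))) {w : ℂ} (hw : w ∈ Ω) :
    1 / 16 ≤ ‖k w + 1‖ := by
  have hzb1 : ‖b - a‖ / 2 ≤ ‖z - b‖ := by
    have := norm_sub_le_norm_sub_add_norm_sub b z a
    rw [norm_sub_rev b z] at this
    linarith
  have hzb2 : ‖z - b‖ ≤ 3 / 2 * ‖b - a‖ := by
    have := norm_sub_le_norm_sub_add_norm_sub z a b
    rw [norm_sub_rev a b] at this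
    linarith
  have hba0 : 0 < ‖b - a‖ := by linarith
  have hzb0 : 0 < ‖z - b‖ := by linarith
  have hzbne : z - b ≠ 0 := norm_pos_iff.1 hzb0
  -- The numerator of k² - 1 factors as (u - z)(b - a).
  have hdiff : ∀ u ∈ Ω, ‖k u ^ 2 - 1‖ * (‖u - a‖ * ‖z - b‖) = ‖u - z‖ * ‖b - a‖ := by
    intro u hu
    have hua : u - a ≠ 0 := sub_ne_zero.2 (by rintro rfl; exact ha hu)
    rw [← norm_mul, ← norm_mul, ← norm_mul, hsq u hu]
    congr 1
    field_simp
    ring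
  have hpos : ∀ u ∈ Ω, 0 < ‖u - a‖ := fun u hu =>
    norm_pos_iff.2 (sub_ne_zero.2 (by rintro rfl; exact ha hu))
  by_contra! hlt
  -- (1/16)(2 + 1/16) < 2/15, and 2/15 is the lower bound for |k² - 1| at distance at least δ/4 from
  -- z; so w lies within δ/4 of z.
  have hsmall : ‖k w ^ 2 - 1‖ < 2 / 15 := by
    have h1 : k w ^ 2 - 1 = (k w + 1) * ((k w + 1) - 2) := by ring
    have h2 : ‖(k w + 1) - 2‖ ≤ ‖k w + 1‖ + 2 := by
      simpa using norm_sub_le (k w + 1) (2 : ℂ)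
    rw [h1, norm_mul]
    nlinarith [norm_nonneg (k w + 1), norm_nonneg ((k w + 1) - 2)]
  have hwz : ‖w - z‖ < δ / 4 := by
    by_contra! hge
    have h1 : ‖w - a‖ ≤ 5 * ‖w - z‖ := by
      linarith [norm_sub_le_norm_sub_add_norm_sub w z a]
    have h2 := hdiff w hw
    have h3 : ‖w - a‖ * ‖z - b‖ ≤ 15 / 2 * (‖w - z‖ * ‖b - a‖) := by
      calc ‖w - a‖ * ‖z - b‖ ≤ (5 * ‖w - z‖) * (3 / 2 * ‖b - a‖) := by gcongr
        _ = _ := by ring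
    have h4 : 0 < ‖w - a‖ * ‖z - b‖ := mul_pos (hpos w hw) hzb0
    nlinarith
  have hsub : ball z (δ / 4) ⊆ Ω := (ball_subset_ball (by linarith)).trans hball
  -- Here |k² - 1| < 1, so k² is never a nonpositive real and k never meets the imaginary axis. As
  -- k(z) = 1, this excludes k(w) near -1.
  have hre : ∀ u ∈ ball z (δ / 4), (k u).re ≠ 0 := by
    intro u hu h0
    have huΩ := hsub hu
    rw [mem_ball, dist_eq_norm] at hu
    have h1 : 3 / 4 * δ ≤ ‖u - a‖ := by
      have := norm_sub_le_norm_sub_add_norm_sub z u a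
      rw [norm_sub_rev z u] at this
      linarith
    have h2 : ‖k u ^ 2 - 1‖ < 1 := by
      by_contra! hge
      have h3 := hdiff u huΩ
      have h4 : 3 / 4 * δ * (‖b - a‖ / 2) ≤ ‖u - a‖ * ‖z - b‖ := by gcongr
      have h5 : ‖u - z‖ * ‖b - a‖ < δ / 4 * ‖b - a‖ := by gcongr
      nlinarith [mul_pos hδ hba0]
    have h3 := Complex.abs_re_le_norm (k u ^ 2 - 1)
    have h4 : (k u ^ 2 - 1).re = -(k u).im ^ 2 - 1 := by
      simp [pow_two, h0]
    rw [h4] at h3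
    have := neg_abs_le (-(k u).im ^ 2 - 1)
    nlinarith [sq_nonneg (k u).im]
  have hwball : w ∈ ball z (δ / 4) := by rwa [mem_ball, dist_eq_norm]
  have hwre : (k w).re < 0 := by
    have := Complex.re_le_norm (k w + 1)
    simp only [Complex.add_re, Complex.one_re] at this
    linarith
  have hivt := ((convex_ball z (δ / 4)).isPreconnected).intermediate_value hwball
    (mem_ball_self (by positivity))
    (Complex.continuous_re.comp_continuousOn (hk.mono hsub))
  obtain ⟨u, hu, hu0⟩ := hivt (show (0 : ℝ) ∈ Icc _ _ by simp [hkz, hwre.le])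
  exact hre u hu hu0

/-- A holomorphic map to the disc, vanishing at `z`, with derivative comparable to `1 / δ`. -/
theorem exists_mapsTo_unitDisc_of_arc {Ω : Set ℂ} (hopen : IsOpen Ω) {z a : ℂ} {δ : ℝ}
    (hδ : 0 < δ) (hz : z ∈ Ω) (hball : ball z δ ⊆ Ω) (hza : ‖z - a‖ = δ)
    (harc : HasArcFrom Ωᶜ a (2 * δ)) :
    ∃ f : ℂ → ℂ, DifferentiableOn ℂ f Ω ∧ MapsTo f Ω unitDisc ∧ f z = 0 ∧
      1 / 204 / δ ≤ ‖deriv f z‖ := by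
  obtain ⟨γ, hγ, h0, hba, hmem⟩ := harc
  obtain ⟨b, hb⟩ : ∃ b, γ 1 = b := ⟨_, rfl⟩
  rw [hb] at hba
  have ha : a ∉ Ω := h0 ▸ hmem 0 (left_mem_Icc.2 zero_le_one)
  have hbΩ : b ∉ Ω := hb ▸ hmem 1 (right_mem_Icc.2 zero_le_one)
  have hne : ∀ w ∈ Ω, ∀ t ∈ Icc (0 : ℝ) 1, γ t ≠ w := fun w hw t ht h => hmem t ht (h ▸ hw)
  have hane : ∀ w ∈ Ω, w - a ≠ 0 := fun w hw => sub_ne_zero.2 (by rintro rfl; exact ha hw)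
  have hbne : ∀ w ∈ Ω, w - b ≠ 0 := fun w hw => sub_ne_zero.2 (fun h => hbΩ (h ▸ hw))
  set g : ℂ → ℂ := fun w => ∫ t in (0 : ℝ)..1, deriv γ t / (γ t - w) with hg
  have hgexp : ∀ w ∈ Ω, Complex.exp (g w) = (w - b) / (w - a) := fun w hw => by
    rw [hg, exp_integral_deriv_div_sub hγ (hne w hw), h0, hb, ← neg_sub w, ← neg_sub w a, neg_div_neg_eq]
  have hgd : ∀ w ∈ Ω, DifferentiableAt ℂ g w := fun w hw =>
    differentiableAt_integral_deriv_div_sub hγ (by rintro ⟨t, ht, h⟩; exact hne w hw t ht h)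
  -- Halving the logarithm takes the square root; subtracting `g z` gives k(z) = 1.
  set k : ℂ → ℂ := fun w => Complex.exp ((g w - g z) / 2) with hk
  have hkd : ∀ w ∈ Ω, DifferentiableAt ℂ k w := fun w hw =>
    (((hgd w hw).sub_const _).div_const _).cexp
  have hkz : k z = 1 := by simp [hk]
  have hksq : ∀ w ∈ Ω, k w ^ 2 = ((w - b) * (z - a)) / ((w - a) * (z - b)) := fun w hw => by
    rw [hk, ← Complex.exp_nat_mul]
    have : ((2 : ℕ) : ℂ) * ((g w - g z) / 2) = g w - g z := by push_cast; ring
    rw [this, Complex.exp_sub, hgexp w hw, hgexp z hz, div_div_div_eq]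
  have hlow : ∀ w ∈ Ω, 1 / 16 ≤ ‖k w + 1‖ := fun w hw =>
    le_norm_sqrt_add_one hδ hball (fun u hu => (hkd u hu).continuousAt.continuousWithinAt) hkz
      hza hba ha hksq hw
  have hk1 : ∀ w ∈ Ω, k w + 1 ≠ 0 := fun w hw h => by
    have := hlow w hw
    rw [h] at this
    norm_num at this
  have hderiv : deriv k z = (b - a) / (2 * ((z - a) * (z - b))) := by
    have h1 : HasDerivAt (fun w => k w ^ 2) (2 * deriv k z) z := by
      simpa [hkz] using (hkd z hz).hasDerivAt.fun_pow 2
    have h2 : HasDerivAt (fun w => ((w - b) * (z - a)) / ((w - a) * (z - b)))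
        ((b - a) / ((z - a) * (z - b))) z := by
      refine ((((hasDerivAt_id z).sub_const b).mul_const (z - a)).fun_div
        (((hasDerivAt_id z).sub_const a).mul_const (z - b))
        (mul_ne_zero (hane z hz) (hbne z hz))).congr_deriv ?_
      have := hane z hz
      have := hbne z hz
      simp only [id]
      field_simp
      ring
    have h3 := h1.unique (h2.congr_of_eventuallyEq
      (Filter.eventually_of_mem (hopen.mem_nhds hz) hksq))
    have := hane z hz
    have := hbne z hz
    rw [eq_div_iff (by simp [*])]
    rw [eq_div_iff (by simp [*])] at h3
    linear_combination h3
  have hfd : ∀ w ∈ Ω, HasDerivAt (fun w => ((k w + 1)⁻¹ - 1 / 2) / 17)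
      (-deriv k w / (k w + 1) ^ 2 / 17) w := fun w hw =>
    ((((hkd w hw).hasDerivAt.add_const 1).inv (hk1 w hw)).sub_const _).div_const _
  -- The shift by 1/2 makes the value at z zero, and 16 + 1/2 < 17.
  refine ⟨fun w => ((k w + 1)⁻¹ - 1 / 2) / 17,
    fun w hw => (hfd w hw).differentiableAt.differentiableWithinAt, fun w hw => ?_, ?_, ?_⟩
  · have h1 : ‖(k w + 1)⁻¹‖ ≤ 16 := by
      rw [norm_inv]
      calc ‖k w + 1‖⁻¹ ≤ (1 / 16)⁻¹ := inv_anti₀ (by norm_num) (hlow w hw)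
        _ = 16 := by norm_num
    have h2 := norm_sub_le (k w + 1)⁻¹ (1 / 2 : ℂ)
    have h3 : ‖(1 / 2 : ℂ)‖ = 1 / 2 := by simp
    have h4 : ‖(17 : ℂ)‖ = 17 := by simp
    rw [unitDisc, mem_ball_zero_iff, norm_div, h4, div_lt_one (by norm_num)]
    linarith
  · simp only [hkz]
    norm_num
  -- Since |z - b| ≤ (3/2)|b - a|, |k'(z)| ≥ 1/(3δ); dividing by |k(z) + 1|² = 4 and by 17 gives
  -- 1/204.
  · have hba0 : 0 < ‖b - a‖ := by linarith
    have hzb0 : 0 < ‖z - b‖ := norm_pos_iff.2 (hbne z hz)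
    have hzb2 : ‖z - b‖ ≤ 3 / 2 * ‖b - a‖ := by
      have := norm_sub_le_norm_sub_add_norm_sub z a b
      rw [norm_sub_rev a b] at this
      linarith
    rw [(hfd z hz).deriv, hderiv, hkz]
    have h2 : ‖(2 : ℂ)‖ = 2 := by simp
    have h11 : ‖(1 + 1 : ℂ)‖ = 2 := by norm_num
    have h4 : ‖(17 : ℂ)‖ = 17 := by simp
    simp only [norm_div, norm_neg, norm_mul, norm_pow, h2, h4, h11, hza]
    rw [div_div, div_div, div_div, div_le_div_iff₀ (by positivity) (by positivity)]
    nlinarith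

/-! ### The two metrics -/

/-- The ball is connected, misses the frontier and meets Ω, so it cannot reach the exterior. -/
theorem ball_boundaryDist_subset {Ω : Set ℂ} (hopen : IsOpen Ω) {z : ℂ} (hz : z ∈ Ω) :
    ball z (boundaryDist Ω z) ⊆ Ω := by
  rcases le_or_gt (boundaryDist Ω z) 0 with h | h
  · simp [ball_eq_empty.2 h]
  refine ((convex_ball z _).isPreconnected).subset_left_of_subset_union hopen
    (isClosed_closure (s := Ω)).isOpen_compl (disjoint_compl_right_iff_subset.2 subset_closure) ?_
    ⟨z, mem_ball_self h, hz⟩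
  intro w hw
  by_contra hcon
  rw [mem_union, not_or, notMem_compl_iff] at hcon
  have hwf : w ∈ frontier Ω := by rw [hopen.frontier_eq]; exact ⟨hcon.2, hcon.1⟩
  have := infDist_le_dist_of_mem (x := z) hwf
  rw [mem_ball, dist_comm] at hw
  exact absurd hw (not_lt.2 this)

theorem kobayashi_nonneg (Ω : Set ℂ) (z ξ : ℂ) : 0 ≤ kobayashi Ω z ξ :=
  Real.sInf_nonneg fun _ h => h.1.le

theorem mem_kobayashi_set {Ω : Set ℂ} {z ξ : ℂ} {δ α : ℝ} (hδ : 0 < δ) (hball : ball z δ ⊆ Ω)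
    (hα : 0 < α) (hle : ‖ξ‖ / δ ≤ α) :
    α ∈ {α : ℝ | 0 < α ∧ ∃ f : ℂ → ℂ, DifferentiableOn ℂ f unitDisc ∧ MapsTo f unitDisc Ω ∧
      f 0 = z ∧ deriv f 0 = ξ / (α : ℂ)} := by
  have hd : ∀ w, HasDerivAt (fun w : ℂ => z + ξ / (α : ℂ) * w) (ξ / (α : ℂ)) w := fun w => by
    simpa using ((hasDerivAt_id w).const_mul (ξ / (α : ℂ))).const_add z
  refine ⟨hα, fun w => z + ξ / (α : ℂ) * w, fun w _ => (hd w).differentiableAt.differentiableWithinAt,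
    fun w hw => hball ?_, by simp, (hd 0).deriv⟩
  rw [unitDisc, mem_ball_zero_iff] at hw
  have h1 : ‖ξ / (α : ℂ)‖ ≤ δ := by
    rw [norm_div, Complex.norm_real, Real.norm_of_nonneg hα.le, div_le_iff₀ hα]
    rwa [div_le_iff₀' hδ] at hle
  rw [mem_ball, dist_eq_norm, add_sub_cancel_left, norm_mul]
  calc ‖ξ / (α : ℂ)‖ * ‖w‖ ≤ δ * ‖w‖ := by gcongr
    _ < δ := by nlinarith

theorem kobayashi_le_of_ball_subset {Ω : Set ℂ} {z ξ : ℂ} {δ : ℝ} (hδ : 0 < δ)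
    (hball : ball z δ ⊆ Ω) : kobayashi Ω z ξ ≤ ‖ξ‖ / δ := by
  -- The ε keeps the competitor α positive when ξ = 0.
  refine le_of_forall_pos_le_add fun ε hε => ?_
  have : 0 ≤ ‖ξ‖ / δ := by positivity
  exact csInf_le ⟨0, fun _ h => h.1.le⟩ (mem_kobayashi_set hδ hball (by linarith) (by linarith))

/-- Schwarz's lemma: every competitor for `caratheodory` is at most every one for `kobayashi`. -/
theorem norm_deriv_mul_le {Ω : Set ℂ} (hopen : IsOpen Ω) {z ξ : ℂ} (hz : z ∈ Ω) {α : ℝ}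
    (hα : 0 < α) {f g : ℂ → ℂ} (hf : DifferentiableOn ℂ f unitDisc) (hfm : MapsTo f unitDisc Ω)
    (hf0 : f 0 = z) (hfd : deriv f 0 = ξ / (α : ℂ)) (hg : DifferentiableOn ℂ g Ω)
    (hgm : MapsTo g Ω unitDisc) (hgz : g z = 0) : ‖deriv g z * ξ‖ ≤ α := by
  subst hf0
  have h1 : ‖deriv (g ∘ f) 0‖ ≤ 1 := by
    refine Complex.norm_deriv_le_one_of_mapsTo_ball (R := 1) (hg.comp hf hfm) ?_ one_pos
    intro w hw
    rw [Function.comp_apply, Function.comp_apply, hgz]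
    exact ball_subset_closedBall (hgm (hfm hw))
  have h2 : deriv (g ∘ f) 0 = deriv g (f 0) * deriv f 0 :=
    deriv_comp 0 (hg.differentiableAt (hopen.mem_nhds hz))
      (hf.differentiableAt (ball_mem_nhds 0 one_pos))
  rwa [h2, hfd, ← mul_div_assoc, norm_div, Complex.norm_real, Real.norm_of_nonneg hα.le,
    div_le_one hα] at h1

theorem norm_deriv_mul_le_kobayashi {Ω : Set ℂ} (hopen : IsOpen Ω) {z ξ : ℂ} (hz : z ∈ Ω)
    {g : ℂ → ℂ} (hg : DifferentiableOn ℂ g Ω) (hgm : MapsTo g Ω unitDisc) (hgz : g z = 0) :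
    ‖deriv g z * ξ‖ ≤ kobayashi Ω z ξ := by
  obtain ⟨δ, hδ, hball⟩ := Metric.isOpen_iff.1 hopen z hz
  have hpos : 0 ≤ ‖ξ‖ / δ := by positivity
  -- Nonemptiness matters: the real `sInf` of the empty set is 0.
  refine le_csInf ⟨_, mem_kobayashi_set (ξ := ξ) (α := ‖ξ‖ / δ + 1) hδ hball (by linarith)
    (by linarith)⟩ ?_
  rintro α ⟨hα, f, hf, hfm, hf0, hfd⟩
  exact norm_deriv_mul_le hopen hz hα hf hfm hf0 hfd hg hgm hgz

theorem caratheodory_le_kobayashi {Ω : Set ℂ} (hopen : IsOpen Ω) {z ξ : ℂ} (hz : z ∈ Ω) :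
    caratheodory Ω z ξ ≤ kobayashi Ω z ξ := by
  refine Real.sSup_le ?_ (kobayashi_nonneg Ω z ξ)
  rintro s ⟨g, hg, hgm, hgz, rfl⟩
  exact norm_deriv_mul_le_kobayashi hopen hz hg hgm hgz

theorem norm_deriv_mul_le_caratheodory {Ω : Set ℂ} (hopen : IsOpen Ω) {z ξ : ℂ} (hz : z ∈ Ω)
    {g : ℂ → ℂ} (hg : DifferentiableOn ℂ g Ω) (hgm : MapsTo g Ω unitDisc) (hgz : g z = 0) :
    ‖deriv g z * ξ‖ ≤ caratheodory Ω z ξ := by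
  refine le_csSup ⟨kobayashi Ω z ξ, ?_⟩ ⟨g, hg, hgm, hgz, rfl⟩
  rintro s ⟨h, hh, hhm, hhz, rfl⟩
  exact norm_deriv_mul_le_kobayashi hopen hz hh hhm hhz

theorem frontier_nonempty_of_isBounded {Ω : Set ℂ} (hne : Ω.Nonempty)
    (hbdd : Bornology.IsBounded Ω) : (frontier Ω).Nonempty := by
  refine nonempty_frontier_iff.2 ⟨hne, ?_⟩
  rintro rfl
  exact NormedSpace.unbounded_univ ℂ ℂ hbdd

theorem boundaryDist_pos {Ω : Set ℂ} (hopen : IsOpen Ω) (hbdd : Bornology.IsBounded Ω) {z : ℂ}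
    (hz : z ∈ Ω) : 0 < boundaryDist Ω z := by
  refine (isClosed_frontier.notMem_iff_infDist_pos
    (frontier_nonempty_of_isBounded ⟨z, hz⟩ hbdd)).1 fun h => ?_
  rw [hopen.frontier_eq] at h
  exact h.2 hz

theorem exists_le_caratheodory {Ω : Set ℂ} (hopen : IsOpen Ω) (hbdd : Bornology.IsBounded Ω)
    (hC2 : HasC2Boundary Ω) :
    ∃ c > 0, ∀ z ∈ Ω, ∀ ξ : ℂ, c * ‖ξ‖ / boundaryDist Ω z ≤ caratheodory Ω z ξ := by
  obtain ⟨d, hd, harc⟩ := exists_uniform_hasArcFrom hbdd hC2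
  obtain ⟨R, hR⟩ := Metric.isBounded_iff.1 hbdd
  set M := max R 0 + 1 with hM
  have hM0 : 0 < M := by positivity
  -- One constant for each regime: 2δ ≤ d, and 2δ > d, where the map (w - z)/M has derivative 1/M >
  -- (d/2/M)/δ.
  refine ⟨min (1 / 204) (d / 2 / M), by positivity, fun z hz ξ => ?_⟩
  have hδ := boundaryDist_pos hopen hbdd hz
  set δ := boundaryDist Ω z with hδdef
  suffices h : ∃ f : ℂ → ℂ, DifferentiableOn ℂ f Ω ∧ MapsTo f Ω unitDisc ∧ f z = 0 ∧
      min (1 / 204) (d / 2 / M) / δ ≤ ‖deriv f z‖ by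
    obtain ⟨f, hf, hfm, hfz, hle⟩ := h
    refine le_trans ?_ (norm_deriv_mul_le_caratheodory hopen hz hf hfm hfz)
    rw [norm_mul, mul_div_right_comm]
    gcongr
  rcases le_or_gt (2 * δ) d with h | h
  · obtain ⟨a, ha, hdist⟩ := isClosed_frontier.exists_infDist_eq_dist
      (frontier_nonempty_of_isBounded ⟨z, hz⟩ hbdd) z
    have harc' : HasArcFrom Ωᶜ a (2 * δ) := by
      obtain ⟨γ, h1, h2, h3, h4⟩ := (harc a ha).mono h
      refine ⟨γ, h1, h2, h3, fun t ht => ?_⟩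
      have := h4 t ht
      rw [hopen.frontier_eq] at this
      exact this.2
    obtain ⟨f, hf, hfm, hfz, hle⟩ := exists_mapsTo_unitDisc_of_arc hopen hδ hz
      (ball_boundaryDist_subset hopen hz) (by rw [← dist_eq_norm, ← hdist]; rfl) harc'
    refine ⟨f, hf, hfm, hfz, le_trans ?_ hle⟩
    gcongr
    exact min_le_left _ _
  · have hder : ∀ w, HasDerivAt (fun w : ℂ => (w - z) / (M : ℂ)) (1 / (M : ℂ)) w := fun w =>
      ((hasDerivAt_id w).sub_const z).div_const _
    have hMn : ‖(M : ℂ)‖ = M := by rw [Complex.norm_real, Real.norm_of_nonneg hM0.le]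
    refine ⟨fun w => (w - z) / (M : ℂ),
      fun w _ => (hder w).differentiableAt.differentiableWithinAt, fun w hw => ?_, by simp, ?_⟩
    · rw [unitDisc, mem_ball_zero_iff, norm_div, hMn, div_lt_one hM0, ← dist_eq_norm]
      linarith [hR hw hz, le_max_left R 0]
    · rw [(hder z).deriv, norm_div, hMn, norm_one, div_le_iff₀ hδ]
      refine (min_le_right _ _).trans ?_
      rw [div_mul_eq_mul_div, one_mul]
      gcongr
      linarith

end PlanarMetric

theorem proposition17 (Ω : Set ℂ) (hopen : IsOpen Ω) (hconn : IsConnected Ω)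
    (hbdd : Bornology.IsBounded Ω) (hC2 : PlanarMetric.HasC2Boundary Ω) :
    (∃ c C : ℝ, 0 < c ∧ 0 < C ∧ ∀ z ∈ Ω, ∀ ξ : ℂ,
      c * ‖ξ‖ / PlanarMetric.boundaryDist Ω z ≤ PlanarMetric.kobayashi Ω z ξ ∧
      PlanarMetric.kobayashi Ω z ξ ≤ C * ‖ξ‖ / PlanarMetric.boundaryDist Ω z) ∧
    (∃ c C : ℝ, 0 < c ∧ 0 < C ∧ ∀ z ∈ Ω, ∀ ξ : ℂ,
      c * ‖ξ‖ / PlanarMetric.boundaryDist Ω z ≤ PlanarMetric.caratheodory Ω z ξ ∧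
      PlanarMetric.caratheodory Ω z ξ ≤ C * ‖ξ‖ / PlanarMetric.boundaryDist Ω z) := by
  obtain ⟨c, hc, hlow⟩ := PlanarMetric.exists_le_caratheodory hopen hbdd hC2
  have hup : ∀ z ∈ Ω, ∀ ξ : ℂ,
      PlanarMetric.kobayashi Ω z ξ ≤ 1 * ‖ξ‖ / PlanarMetric.boundaryDist Ω z := fun z hz ξ => by
    rw [one_mul]
    exact PlanarMetric.kobayashi_le_of_ball_subset (PlanarMetric.boundaryDist_pos hopen hbdd hz)
      (PlanarMetric.ball_boundaryDist_subset hopen hz)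
  have hmid : ∀ z ∈ Ω, ∀ ξ : ℂ,
      PlanarMetric.caratheodory Ω z ξ ≤ PlanarMetric.kobayashi Ω z ξ := fun z hz ξ =>
    PlanarMetric.caratheodory_le_kobayashi hopen hz
  exact ⟨⟨c, 1, hc, one_pos, fun z hz ξ => ⟨(hlow z hz ξ).trans (hmid z hz ξ), hup z hz ξ⟩⟩,
    ⟨c, 1, hc, one_pos, fun z hz ξ => ⟨hlow z hz ξ, (hmid z hz ξ).trans (hup z hz ξ)⟩⟩⟩
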